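/- Theorem. Let $n\ge 2$ and $m\ge 0$ be integers. Let $\mathcal{E}'(\mathbb{R}^n)$ be the space of compactly supported (real- or complex-valued) distributions on $\mathbb{R}^n$, i.e. the dual of $C^\infty(\mathbb{R}^n)$. For $p\ge 0$ let $\mathcal{E}'(S^p)$ be the space of compactly supported symmetric $p$-tensor field distributions $f=(f_{i_1\cdots i_p})_{1\le i_1,\dots,i_p\le n}$, with components $f_{i_1\cdots i_p}\in\mathcal{E}'(\mathbb{R}^n)$ that are symmetric in the indices, and let $$\mathcal{E}'(\mathbf{S}^m)=\mathcal{E}'(S^0)\oplus\mathcal{E}'(S^1)\oplus\cdots\oplus\mathcal{E}'(S^m),$$ whose elements are written $F=f^{(0)}+f^{(1)}+\cdots+f^{(m)}$ with $f^{(p)}\in\mathcal{E}'(S^p)$. For every integer $k\ge 0$ the generalized momentum ray transform $I^{m,k}F\in\mathcal{D}'\big(\mathbb{R}^n\times(\mathbb{R}^n\setminus\{0\})\big)$ of $F\in\mathcal{E}'(\mathbf{S}^m)$ is the distribution defined by $$\langle I^{m,k}F,\Psi\rangle=\sum_{p=0}^{m}\ \sum_{i_1,\dots,i_p=1}^{n}\Big\langle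 f^{(p)}_{i_1\cdots i_p},\ \int_{\mathbb{R}^n}\int_{\mathbb{R}}t^k\,\xi^{i_1}\cdots\xi^{i_p}\,\Psi(x-t\xi,\xi)\,\mathrm{d}t\,\mathrm{d}\xi\Big\rangle ,\qquad \Psi\in C_c^\infty\big(\mathbb{R}^n\times(\mathbb{R}^n\setminus\{0\})\big),$$ where the double integral is a smooth function of $x\in\mathbb{R}^n$. (If all components of $F$ are smooth and compactly supported, $I^{m,k}F$ is the function $(x,\xi)\mapsto\int_{\mathbb{R}}t^k\sum_{p=0}^m\sum_{i_1,\dots,i_p} f^{(p)}_{i_1\cdots i_p}(x+t\xi)\,\xi^{i_1}\cdots\xi^{i_p}\,\mathrm{d}t$.) Let $F\in\mathcal{E}'(\mathbf{S}^m)$. If $I^{m,k}F=0$ in $\mathcal{D}'\big(\mathbb{R}^n\times(\mathbb{R}^n\setminus\{0\})\big)$ for $k=0,1,\dots,m$, then $F=0$, i.e. $f^{(p)}=0$ for all $0\le p\le m$. -/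

import Mathlib

open MeasureTheory TopologicalSpace
open scoped Distributions ContDiff

/-! ### Smooth functions and compactly supported distributions -/

/-- The space `C^∞(ℝⁿ)` of (real-valued) smooth functions. -/
def SmoothFun (n : ℕ) : Submodule ℝ (EuclideanSpace ℝ (Fin n) → ℝ) where
  carrier := {φ | ContDiff ℝ ∞ φ}
  add_mem' {φ ψ} (hφ : ContDiff ℝ ∞ φ) (hψ : ContDiff ℝ ∞ ψ) := hφ.add hψ
  zero_mem' := (contDiff_const : ContDiff ℝ ∞ fun _ => (0 : ℝ))
  smul_mem' c φ (hφ : ContDiff ℝ ∞ φ) := hφ.const_smul c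

/-- The space `ℰ'(ℝⁿ)` of compactly supported distributions with values in `𝕜`, as the dual of
`C^∞(ℝⁿ)`: the linear forms `u` for which there are a compact set `K`, an order `N` and a constant
`C` with `|u(φ)| ≤ C * sup_{j ≤ N, x ∈ K} |D^j φ(x)|` for all smooth `φ`. As for Mathlib's
`Distribution`, scalar-valued distributions are tested against real-valued functions. -/
def CompactDistribution (𝕜 : Type*) [RCLike 𝕜] (n : ℕ) :
    Submodule ℝ (SmoothFun n →ₗ[ℝ] 𝕜) where
  carrier := {u | ∃ (K : Set (EuclideanSpace ℝ (Fin n))) (N : ℕ) (C : ℝ), IsCompact K ∧ 0 ≤ C ∧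
    ∀ (φ : SmoothFun n) (B : ℝ), 0 ≤ B →
      (∀ j ≤ N, ∀ x ∈ K, ‖iteratedFDeriv ℝ j φ.1 x‖ ≤ B) → ‖u φ‖ ≤ C * B}
  add_mem' := by
    rintro u v ⟨K, N, C, hK, hC, hu⟩ ⟨K', N', C', hK', hC', hv⟩
    refine ⟨K ∪ K', max N N', C + C', hK.union hK', add_nonneg hC hC', fun φ B hB h => ?_⟩
    have h1 := hu φ B hB fun j hj x hx => h j (hj.trans (le_max_left _ _)) x (Or.inl hx)
    have h2 := hv φ B hB fun j hj x hx => h j (hj.trans (le_max_right _ _)) x (Or.inr hx)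
    rw [LinearMap.add_apply, add_mul]
    exact (norm_add_le _ _).trans (add_le_add h1 h2)
  zero_mem' := ⟨∅, 0, 0, isCompact_empty, le_rfl, fun φ B hB _ => by simp⟩
  smul_mem' := by
    rintro c u ⟨K, N, C, hK, hC, hu⟩
    refine ⟨K, N, ‖c‖ * C, hK, by positivity, fun φ B hB h => ?_⟩
    rw [LinearMap.smul_apply, norm_smul, mul_assoc]
    exact mul_le_mul_of_nonneg_left (hu φ B hB h) (norm_nonneg c)

/-- The space `ℰ'(S^p)` of compactly supported symmetric `p`-tensor field distributions on `ℝⁿ`,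
given by their components `f_{i₁ ⋯ iₚ} ∈ ℰ'(ℝⁿ)`. -/
def SymTensorDistribution (𝕜 : Type*) [RCLike 𝕜] (n p : ℕ) :
    Submodule ℝ ((Fin p → Fin n) → CompactDistribution 𝕜 n) where
  carrier := {f | ∀ (σ : Equiv.Perm (Fin p)) (i : Fin p → Fin n), f (i ∘ σ) = f i}
  add_mem' hf hg σ i := by simp only [Pi.add_apply, hf σ i, hg σ i]
  zero_mem' _ _ := rfl
  smul_mem' c f hf σ i := by simp only [Pi.smul_apply, hf σ i]

/-- The space `ℰ'(𝐒^m)` with `𝐒^m = S^0 ⊕ S^1 ⊕ ⋯ ⊕ S^m`: its elements are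
`F = f^{(0)} + f^{(1)} + ⋯ + f^{(m)}` with `f^{(p)} ∈ ℰ'(S^p)`. -/
abbrev TensorSumDistribution (𝕜 : Type*) [RCLike 𝕜] (n m : ℕ) : Type _ :=
  (p : Fin (m + 1)) → SymTensorDistribution 𝕜 n p

/-- The open set `ℝⁿ × (ℝⁿ ∖ {0})`. -/
def nonzeroDirections (n : ℕ) :
    Opens (EuclideanSpace ℝ (Fin n) × EuclideanSpace ℝ (Fin n)) :=
  ⟨{q | q.2 ≠ 0}, isOpen_ne_fun continuous_snd continuous_const⟩

/-! ### Analytic facts that make the adjoint transform well defined -/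

section RayIntegral

variable {n : ℕ} {G : Type} [NormedAddCommGroup G] [NormedSpace ℝ G]

/-- The integral `∫ a(ξ,t) g(x - tξ, ξ) d(ξ,t)` over `ℝⁿ × ℝ`. -/
noncomputable def rayIntegral (a : EuclideanSpace ℝ (Fin n) × ℝ → ℝ)
    (g : EuclideanSpace ℝ (Fin n) × EuclideanSpace ℝ (Fin n) → G)
    (x : EuclideanSpace ℝ (Fin n)) : G :=
  ∫ q : EuclideanSpace ℝ (Fin n) × ℝ, a q • g (x - q.2 • q.1, q.1)

theorem exists_compact_rays {K : Set (EuclideanSpace ℝ (Fin n) × EuclideanSpace ℝ (Fin n))}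
    (hK : IsCompact K) (hKΩ : K ⊆ nonzeroDirections n) (R : ℝ) :
    ∃ L : Set (EuclideanSpace ℝ (Fin n) × ℝ), IsCompact L ∧
      ∀ x ∈ Metric.ball (0 : EuclideanSpace ℝ (Fin n)) R, ∀ q ∉ L,
        (x - q.2 • q.1, q.1) ∉ K := by
  obtain ⟨M, hM⟩ := hK.isBounded.exists_norm_le
  obtain ⟨δ, hδ, hδK⟩ : ∃ δ : ℝ, 0 < δ ∧ ∀ q ∈ K, δ ≤ ‖q.2‖ := by
    rcases K.eq_empty_or_nonempty with rfl | hne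
    · exact ⟨1, one_pos, by simp⟩
    · obtain ⟨q₀, hq₀, hmin⟩ := hK.exists_isMinOn hne
        (f := fun q => ‖q.2‖) continuous_snd.norm.continuousOn
      have hq₀' : q₀.2 ≠ 0 := hKΩ hq₀
      exact ⟨‖q₀.2‖, norm_pos_iff.2 hq₀', fun q hq => isMinOn_iff.1 hmin q hq⟩
  refine ⟨Metric.closedBall 0 M ×ˢ Metric.closedBall 0 ((R + M) / δ),
    (isCompact_closedBall _ _).prod (isCompact_closedBall _ _), ?_⟩
  rintro x hx ⟨ξ, t⟩ hq hmem
  apply hq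
  have h := hM (x - t • ξ, ξ) hmem
  rw [Prod.norm_mk] at h
  have h1 : ‖x - t • ξ‖ ≤ M := (le_max_left _ _).trans h
  have h2 : ‖ξ‖ ≤ M := (le_max_right _ _).trans h
  have h3 : δ ≤ ‖ξ‖ := hδK (x - t • ξ, ξ) hmem
  have hx' : ‖x‖ < R := mem_ball_zero_iff.1 hx
  refine Set.mk_mem_prod (mem_closedBall_zero_iff.2 h2) (mem_closedBall_zero_iff.2 ?_)
  rw [le_div_iff₀ hδ]
  have h4 : ‖t • ξ‖ ≤ ‖x‖ + ‖x - t • ξ‖ := by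
    have h5 := norm_sub_le x (x - t • ξ)
    rwa [sub_sub_cancel] at h5
  rw [norm_smul] at h4
  calc ‖t‖ * δ ≤ ‖t‖ * ‖ξ‖ := mul_le_mul_of_nonneg_left h3 (norm_nonneg t)
    _ ≤ R + M := h4.trans (add_le_add hx'.le h1)

theorem continuous_rayIntegrand {a : EuclideanSpace ℝ (Fin n) × ℝ → ℝ} (ha : Continuous a)
    {g : EuclideanSpace ℝ (Fin n) × EuclideanSpace ℝ (Fin n) → G} (hg : Continuous g)
    (x : EuclideanSpace ℝ (Fin n)) :
    Continuous fun q : EuclideanSpace ℝ (Fin n) × ℝ => a q • g (x - q.2 • q.1, q.1) :=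
  ha.smul (hg.comp (by fun_prop))

theorem integrable_rayIntegrand {a : EuclideanSpace ℝ (Fin n) × ℝ → ℝ} (ha : Continuous a)
    {K : Set (EuclideanSpace ℝ (Fin n) × EuclideanSpace ℝ (Fin n))}
    (hK : IsCompact K) (hKΩ : K ⊆ nonzeroDirections n)
    {g : EuclideanSpace ℝ (Fin n) × EuclideanSpace ℝ (Fin n) → G} (hg : Continuous g)
    (hgK : ∀ q ∉ K, g q = 0) (x : EuclideanSpace ℝ (Fin n)) :
    Integrable fun q : EuclideanSpace ℝ (Fin n) × ℝ => a q • g (x - q.2 • q.1, q.1) := by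
  obtain ⟨L, hL, hLK⟩ := exists_compact_rays hK hKΩ (‖x‖ + 1)
  refine (continuous_rayIntegrand ha hg x).integrable_of_hasCompactSupport
    (HasCompactSupport.intro hL fun q hq => ?_)
  rw [hgK _ (hLK x (by simp) q hq), smul_zero]

/-- The partial derivative in the first variable. -/
noncomputable def fstDeriv (g : EuclideanSpace ℝ (Fin n) × EuclideanSpace ℝ (Fin n) → G) :
    EuclideanSpace ℝ (Fin n) × EuclideanSpace ℝ (Fin n) → EuclideanSpace ℝ (Fin n) →L[ℝ] G :=
  fun q => (fderiv ℝ g q).comp (ContinuousLinearMap.inl ℝ _ _)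

theorem contDiff_fstDeriv {g : EuclideanSpace ℝ (Fin n) × EuclideanSpace ℝ (Fin n) → G}
    (hg : ContDiff ℝ ∞ g) : ContDiff ℝ ∞ (fstDeriv g) :=
  (hg.fderiv_right (m := ∞) (by simp)).clm_comp contDiff_const

theorem fstDeriv_eq_zero {K : Set (EuclideanSpace ℝ (Fin n) × EuclideanSpace ℝ (Fin n))}
    (hK : IsCompact K) {g : EuclideanSpace ℝ (Fin n) × EuclideanSpace ℝ (Fin n) → G}
    (hgK : ∀ q ∉ K, g q = 0) : ∀ q ∉ K, fstDeriv g q = 0 := by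
  intro q hq
  have h : g =ᶠ[nhds q] fun _ => 0 :=
    Filter.mem_of_superset (hK.isClosed.isOpen_compl.mem_nhds hq) fun y hy => hgK y hy
  rw [fstDeriv, h.fderiv_eq]
  simp

theorem norm_iteratedFDeriv_fstDeriv_le
    {g : EuclideanSpace ℝ (Fin n) × EuclideanSpace ℝ (Fin n) → G} (hg : ContDiff ℝ ∞ g) (j : ℕ)
    (q : EuclideanSpace ℝ (Fin n) × EuclideanSpace ℝ (Fin n)) :
    ‖iteratedFDeriv ℝ j (fstDeriv g) q‖ ≤ ‖iteratedFDeriv ℝ (j + 1) g q‖ := by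
  have hinl : ‖ContinuousLinearMap.inl ℝ (EuclideanSpace ℝ (Fin n))
      (EuclideanSpace ℝ (Fin n))‖ ≤ 1 :=
    ContinuousLinearMap.opNorm_le_bound _ zero_le_one fun x => by simp
  have h := ((ContinuousLinearMap.compL ℝ (EuclideanSpace ℝ (Fin n))
    (EuclideanSpace ℝ (Fin n) × EuclideanSpace ℝ (Fin n)) G).flip
      (ContinuousLinearMap.inl ℝ _ _)).norm_iteratedFDeriv_comp_left
    (f := fderiv ℝ g) (x := q) (N := ∞) (n := j)
    (hg.fderiv_right (m := ∞) (by simp)).contDiffAt (by exact_mod_cast le_top)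
  rw [norm_iteratedFDeriv_fderiv] at h
  refine h.trans (mul_le_of_le_one_left (norm_nonneg _) ?_)
  refine ContinuousLinearMap.opNorm_le_bound _ zero_le_one fun A => ?_
  rw [one_mul]
  exact (A.opNorm_comp_le _).trans (mul_le_of_le_one_right (norm_nonneg _) hinl)

theorem hasFDerivAt_rayIntegral {a : EuclideanSpace ℝ (Fin n) × ℝ → ℝ} (ha : Continuous a)
    {K : Set (EuclideanSpace ℝ (Fin n) × EuclideanSpace ℝ (Fin n))}
    (hK : IsCompact K) (hKΩ : K ⊆ nonzeroDirections n)
    {g : EuclideanSpace ℝ (Fin n) × EuclideanSpace ℝ (Fin n) → G} (hg : ContDiff ℝ ∞ g)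
    (hgK : ∀ q ∉ K, g q = 0) (x : EuclideanSpace ℝ (Fin n)) :
    HasFDerivAt (rayIntegral a g) (rayIntegral a (fstDeriv g) x) x := by
  obtain ⟨L, hL, hLK⟩ := exists_compact_rays hK hKΩ (‖x‖ + 1)
  have hg' := (contDiff_fstDeriv hg).continuous
  have hgK' := fstDeriv_eq_zero hK hgK
  obtain ⟨C, hC⟩ := hg'.bounded_above_of_compact_support (HasCompactSupport.intro hK hgK')
  refine hasFDerivAt_integral_of_dominated_of_fderiv_le
    (F := fun x (q : EuclideanSpace ℝ (Fin n) × ℝ) => a q • g (x - q.2 • q.1, q.1))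
    (F' := fun x q => a q • fstDeriv g (x - q.2 • q.1, q.1))
    (s := Metric.ball 0 (‖x‖ + 1)) (bound := L.indicator fun q => ‖a q‖ * C)
    (Metric.isOpen_ball.mem_nhds (by simp))
    (Filter.Eventually.of_forall fun y =>
      (continuous_rayIntegrand ha hg.continuous y).aestronglyMeasurable)
    (integrable_rayIntegrand ha hK hKΩ hg.continuous hgK x)
    (continuous_rayIntegrand ha hg' x).aestronglyMeasurable
    (Filter.Eventually.of_forall fun q y hy => ?_) ?_
    (Filter.Eventually.of_forall fun q y hy => ?_)
  · by_cases hq : q ∈ L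
    · rw [Set.indicator_of_mem hq, norm_smul]
      exact mul_le_mul_of_nonneg_left (hC _) (norm_nonneg _)
    · rw [Set.indicator_of_notMem hq, hgK' _ (hLK y hy q hq), smul_zero, norm_zero]
  · rw [integrable_indicator_iff hL.measurableSet]
    exact (ha.norm.mul continuous_const).continuousOn.integrableOn_compact hL
  · have h1 : HasFDerivAt (fun y : EuclideanSpace ℝ (Fin n) => (y - q.2 • q.1, q.1))
        (ContinuousLinearMap.inl ℝ _ _) y :=
      ((hasFDerivAt_id y).sub_const _).prodMk (hasFDerivAt_const q.1 y)
    exact (((hg.differentiable (by simp)) _).hasFDerivAt.comp y h1).const_smul (a q)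

theorem contDiff_rayIntegral {a : EuclideanSpace ℝ (Fin n) × ℝ → ℝ} (ha : Continuous a)
    {K : Set (EuclideanSpace ℝ (Fin n) × EuclideanSpace ℝ (Fin n))}
    (hK : IsCompact K) (hKΩ : K ⊆ nonzeroDirections n) (j : ℕ) :
    ∀ {G : Type} [NormedAddCommGroup G] [NormedSpace ℝ G]
      {g : EuclideanSpace ℝ (Fin n) × EuclideanSpace ℝ (Fin n) → G},
      ContDiff ℝ ∞ g → (∀ q ∉ K, g q = 0) → ContDiff ℝ j (rayIntegral a g) := by
  induction j with
  | zero =>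
    intro G _ _ g hg hgK
    exact contDiff_zero.2 (continuous_iff_continuousAt.2 fun x =>
      (hasFDerivAt_rayIntegral ha hK hKΩ hg hgK x).continuousAt)
  | succ j ih =>
    intro G _ _ g hg hgK
    exact_mod_cast contDiff_succ_iff_hasFDerivAt.2 ⟨rayIntegral a (fstDeriv g),
      ih (contDiff_fstDeriv hg) (fstDeriv_eq_zero hK hgK),
      hasFDerivAt_rayIntegral ha hK hKΩ hg hgK⟩

theorem norm_iteratedFDeriv_rayIntegral_le {a : EuclideanSpace ℝ (Fin n) × ℝ → ℝ}
    (ha : Continuous a) {K : Set (EuclideanSpace ℝ (Fin n) × EuclideanSpace ℝ (Fin n))}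
    (hK : IsCompact K) (hKΩ : K ⊆ nonzeroDirections n) {R : ℝ}
    {L : Set (EuclideanSpace ℝ (Fin n) × ℝ)} (hL : IsCompact L)
    (hLK : ∀ x ∈ Metric.ball (0 : EuclideanSpace ℝ (Fin n)) R, ∀ q ∉ L,
        (x - q.2 • q.1, q.1) ∉ K) (j : ℕ) :
    ∀ {G : Type} [NormedAddCommGroup G] [NormedSpace ℝ G]
      {g : EuclideanSpace ℝ (Fin n) × EuclideanSpace ℝ (Fin n) → G} {B : ℝ},
      ContDiff ℝ ∞ g → (∀ q ∉ K, g q = 0) → (∀ q, ‖iteratedFDeriv ℝ j g q‖ ≤ B) →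
      ∀ x ∈ Metric.ball (0 : EuclideanSpace ℝ (Fin n)) R,
        ‖iteratedFDeriv ℝ j (rayIntegral a g) x‖ ≤ (∫ q in L, ‖a q‖) * B := by
  induction j with
  | zero =>
    intro G _ _ g B hg hgK hB x hx
    simp only [norm_iteratedFDeriv_zero] at hB ⊢
    have hB0 : ∀ q, ‖a q • g (x - q.2 • q.1, q.1)‖ ≤ L.indicator (fun q => ‖a q‖ * B) q := by
      intro q
      by_cases hq : q ∈ L
      · rw [Set.indicator_of_mem hq, norm_smul]
        exact mul_le_mul_of_nonneg_left (hB _) (norm_nonneg _)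
      · rw [Set.indicator_of_notMem hq, hgK _ (hLK x hx q hq), smul_zero, norm_zero]
    rw [← integral_mul_const, ← integral_indicator hL.measurableSet]
    refine norm_integral_le_of_norm_le ?_ (Filter.Eventually.of_forall hB0)
    rw [integrable_indicator_iff hL.measurableSet]
    exact (ha.norm.mul continuous_const).continuousOn.integrableOn_compact hL
  | succ j ih =>
    intro G _ _ g B hg hgK hB x hx
    rw [← norm_iteratedFDeriv_fderiv, show fderiv ℝ (rayIntegral a g) = rayIntegral a (fstDeriv g)
      from funext fun y => (hasFDerivAt_rayIntegral ha hK hKΩ hg hgK y).fderiv]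
    exact ih (contDiff_fstDeriv hg) (fstDeriv_eq_zero hK hgK)
      (fun q => (norm_iteratedFDeriv_fstDeriv_le hg j q).trans (hB q)) x hx

end RayIntegral

/-! ### Momentum ray transforms -/

section MomentumRayTransform

variable {n : ℕ}

theorem adjointMRT_eq_rayIntegral (k : ℕ) {p : ℕ} (i : Fin p → Fin n)
    (ψ : 𝓓(nonzeroDirections n, ℝ)) (x : EuclideanSpace ℝ (Fin n)) :
    ∫ ξ : EuclideanSpace ℝ (Fin n), ∫ t : ℝ, t ^ k * (∏ j, ξ (i j)) * ψ (x - t • ξ, ξ) =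
      rayIntegral (fun q => q.2 ^ k * ∏ j, q.1 (i j)) ψ x :=
  (integral_prod _ (integrable_rayIntegrand
    (a := fun q => q.2 ^ k * ∏ j, q.1 (i j)) (by fun_prop) ψ.hasCompactSupport ψ.tsupport_subset
    ψ.continuous (fun _ hq => image_eq_zero_of_notMem_tsupport hq) x)).symm

/-- The component `[(I^k)^* ψ]_{i₁ ⋯ iₚ}` of the adjoint momentum ray transform, the smooth
function `x ↦ ∫_{ℝⁿ} ∫_ℝ t^k ξ^{i₁} ⋯ ξ^{iₚ} ψ(x - tξ, ξ) dt dξ`. -/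
noncomputable def adjointMRT (k : ℕ) {p : ℕ} (i : Fin p → Fin n)
    (ψ : 𝓓(nonzeroDirections n, ℝ)) : SmoothFun n :=
  ⟨fun x => ∫ ξ : EuclideanSpace ℝ (Fin n), ∫ t : ℝ,
      t ^ k * (∏ j, ξ (i j)) * ψ (x - t • ξ, ξ), by
    rw [funext (adjointMRT_eq_rayIntegral k i ψ)]
    exact contDiff_infty.2 fun j => contDiff_rayIntegral (by fun_prop) ψ.hasCompactSupport
      ψ.tsupport_subset j ψ.contDiff fun _ hq => image_eq_zero_of_notMem_tsupport hq⟩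

theorem coe_adjointMRT (k : ℕ) {p : ℕ} (i : Fin p → Fin n) (ψ : 𝓓(nonzeroDirections n, ℝ)) :
    (adjointMRT k i ψ).1 = rayIntegral (fun q => q.2 ^ k * ∏ j, q.1 (i j)) ψ :=
  funext (adjointMRT_eq_rayIntegral k i ψ)

theorem adjointMRT_add (k : ℕ) {p : ℕ} (i : Fin p → Fin n) (ψ χ : 𝓓(nonzeroDirections n, ℝ)) :
    adjointMRT k i (ψ + χ) = adjointMRT k i ψ + adjointMRT k i χ := by
  have hint (ψ : 𝓓(nonzeroDirections n, ℝ)) (x : EuclideanSpace ℝ (Fin n)) :=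
    integrable_rayIntegrand (a := fun q => q.2 ^ k * ∏ j, q.1 (i j)) (by fun_prop)
      ψ.hasCompactSupport ψ.tsupport_subset ψ.continuous
      (fun _ hq => image_eq_zero_of_notMem_tsupport hq) x
  refine Subtype.ext (funext fun x => ?_)
  rw [Submodule.coe_add, Pi.add_apply, coe_adjointMRT, coe_adjointMRT, coe_adjointMRT]
  simp only [rayIntegral]
  rw [← integral_add (hint ψ x) (hint χ x)]
  simp [mul_add]

theorem adjointMRT_smul (k : ℕ) {p : ℕ} (i : Fin p → Fin n) (c : ℝ)
    (ψ : 𝓓(nonzeroDirections n, ℝ)) : adjointMRT k i (c • ψ) = c • adjointMRT k i ψ := by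
  refine Subtype.ext (funext fun x => ?_)
  rw [Submodule.coe_smul, Pi.smul_apply, coe_adjointMRT, coe_adjointMRT]
  simp only [rayIntegral]
  rw [← integral_smul]
  simp [mul_left_comm]

variable {𝕜 : Type*} [RCLike 𝕜]

theorem continuous_pairing_adjointMRT (k : ℕ) {p : ℕ} (i : Fin p → Fin n)
    (u : CompactDistribution 𝕜 n)
    (K : Compacts (EuclideanSpace ℝ (Fin n) × EuclideanSpace ℝ (Fin n)))
    (hK : (K : Set (EuclideanSpace ℝ (Fin n) × EuclideanSpace ℝ (Fin n))) ⊆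
      nonzeroDirections n) :
    Continuous ((fun ψ : 𝓓(nonzeroDirections n, ℝ) => u.1 (adjointMRT k i ψ)) ∘
      TestFunction.ofSupportedIn hK) := by
  obtain ⟨K', N, C, hK', hC, hu⟩ := u.2
  obtain ⟨R, hR⟩ := hK'.isBounded.subset_ball 0
  obtain ⟨L, hL, hLK⟩ := exists_compact_rays K.isCompact hK R
  refine (ContDiffMapSupportedIn.mkCLMtoNormedSpace ℝ
    (fun ψ => u.1 (adjointMRT k i (TestFunction.ofSupportedIn hK ψ))) (fun ψ χ => ?_)
    (fun c ψ => ?_) ⟨Finset.Iic N, C * ∫ q in L, ‖q.2 ^ k * ∏ j, q.1 (i j)‖, by positivity,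
      fun ψ => ?_⟩).continuous
  · rw [← map_add, ← adjointMRT_add]
    rfl
  · rw [← map_smul, ← adjointMRT_smul]
    rfl
  · rw [mul_assoc]
    refine hu _ _ (by positivity) fun j hj x hx => ?_
    rw [coe_adjointMRT]
    refine norm_iteratedFDeriv_rayIntegral_le (by fun_prop) K.isCompact hK hL hLK j ψ.contDiff
      (fun q hq => ψ.zero_on_compl hq) (fun q => ?_) x (hR hx)
    exact (ContDiffMapSupportedIn.norm_iteratedFDeriv_apply_le_seminorm_top ℝ).trans
      (Seminorm.le_finset_sup_apply
        (p := fun j => ContDiffMapSupportedIn.seminorm ℝ _ ℝ ⊤ K j) (Finset.mem_Iic.2 hj))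

/-- The contribution `ψ ↦ ⟨u, [(I^k)^* ψ]_{i₁ ⋯ iₚ}⟩` of a single component `u = f_{i₁ ⋯ iₚ}`, a
distribution on `ℝⁿ × (ℝⁿ ∖ {0})`. -/
noncomputable def componentMRT (k : ℕ) {p : ℕ} (i : Fin p → Fin n)
    (u : CompactDistribution 𝕜 n) : 𝓓'(nonzeroDirections n, 𝕜) :=
  TestFunction.mkCLM ℝ (fun ψ => u.1 (adjointMRT k i ψ))
    (fun ψ χ => by rw [adjointMRT_add, map_add])
    (fun c ψ => by rw [adjointMRT_smul, map_smul])
    (continuous_pairing_adjointMRT k i u)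

/-- The momentum ray transform `I^k f ∈ 𝓓'(ℝⁿ × (ℝⁿ ∖ {0}))` of `f ∈ ℰ'(S^p)`, that is
`⟨I^k f, ψ⟩ = ⟨f, (I^k)^* ψ⟩ = ∑_{i₁, …, iₚ} ⟨f_{i₁ ⋯ iₚ}, [(I^k)^* ψ]_{i₁ ⋯ iₚ}⟩`. -/
noncomputable def momentumRayTransform (k : ℕ) {p : ℕ} (f : SymTensorDistribution 𝕜 n p) :
    𝓓'(nonzeroDirections n, 𝕜) :=
  ∑ i : Fin p → Fin n, componentMRT k i (f.1 i)

/-- The generalized momentum ray transform `I^{m,k} F = ∑_{p ≤ m} I^k f^{(p)}` of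
`F = f^{(0)} + ⋯ + f^{(m)} ∈ ℰ'(𝐒^m)`. -/
noncomputable def generalizedMRT (k : ℕ) {m : ℕ} (F : TensorSumDistribution 𝕜 n m) :
    𝓓'(nonzeroDirections n, 𝕜) :=
  ∑ p : Fin (m + 1), momentumRayTransform k (F p)

end MomentumRayTransform

/-! Take a test function b(ξ) ρ(⟪ξ, x⟫) ⟪y', x⟫^l, where y' = ‖ξ‖² y - ⟪y, ξ⟫ ξ is orthogonal to ξ,
so that the last factor is constant along lines of direction ξ. Integrating over t against t^k turns
the ρ factor into a polynomial in ⟪ξ, x⟫ of degree k with leading coefficient a multiple of ∫ ρ. On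
a ball the adjoint transform is thus an average over ξ of polynomials in x. Letting b vary localizes
at each ξ ≠ 0, and induction on k (`contraction_ridge_eq_zero`) gives, with L_ξ = ∑ ξ^{i₁} ⋯ ξ^{iₚ}
f_{i₁ ⋯ iₚ} summed over all p and all indices, L_ξ(⟪ξ, x⟫^k ⟪y', x⟫^l) = 0 for k ≤ m and every l.

The heart of the proof is to remove the bound on k. Expand ‖ξ‖^{2l} ⟪y, x⟫^l by the binomial theorem
from ‖ξ‖² y = ⟪y, ξ⟫ ξ + y'. The surviving terms all carry the factor ⟪y, ξ⟫^{m+1}. On a line ξ = η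
+ s y with 0 ≠ η ⊥ y, which exists since n ≥ 2, L_ξ(⟪y, x⟫^l) is a polynomial in s of degree at most
m that vanishes to order m + 1 at s = 0, so it is zero (`contraction_linForm_pow_of_inner_eq_zero`).
A limit covers ξ parallel to y.

Scaling ξ separates the degrees p. Polarization in ξ isolates the components
(`symmetric_tensor_eq_zero`), and polarization in y passes from powers ⟪y, x⟫^l to all monomials.
Each component therefore kills every polynomial, and polynomials are dense in C^∞
(`compactDistribution_eq_zero`). -/

/-! ### Polynomial test functions -/

section PolynomialTestFunctions

variable {n : ℕ} {𝕜 : Type*} [RCLike 𝕜]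

/-- The smooth function defined by a polynomial in the coordinates. -/
noncomputable def polyFun (n : ℕ) : MvPolynomial (Fin n) ℝ →ₗ[ℝ] SmoothFun n where
  toFun q := ⟨fun x => MvPolynomial.eval (fun a => x a) q, by
    change ContDiff ℝ ∞ _
    simp only [MvPolynomial.eval_eq]
    fun_prop⟩
  map_add' p q := Subtype.ext (funext fun x => by simp)
  map_smul' c q := Subtype.ext (funext fun x => by simp [MvPolynomial.smul_eval])

theorem polyFun_apply (q : MvPolynomial (Fin n) ℝ) (x : EuclideanSpace ℝ (Fin n)) :
    (polyFun n q).1 x = MvPolynomial.eval (fun a => x a) q := rfl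

/-- The linear form `∑ vₐ Xₐ`. -/
noncomputable def linForm (v : EuclideanSpace ℝ (Fin n)) : MvPolynomial (Fin n) ℝ :=
  ∑ a, MvPolynomial.C (v a) * MvPolynomial.X a

theorem eval_linForm (v x : EuclideanSpace ℝ (Fin n)) :
    MvPolynomial.eval (fun a => x a) (linForm v) = inner ℝ v x := by
  simp [linForm, PiLp.inner_apply, mul_comm]

theorem linForm_add (v w : EuclideanSpace ℝ (Fin n)) :
    linForm (v + w) = linForm v + linForm w := by
  simp [linForm, add_mul, Finset.sum_add_distrib]

theorem linForm_smul (c : ℝ) (v : EuclideanSpace ℝ (Fin n)) :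
    linForm (c • v) = MvPolynomial.C c * linForm v := by
  simp [linForm, Finset.mul_sum, mul_assoc]

theorem linForm_zero : linForm (0 : EuclideanSpace ℝ (Fin n)) = 0 := by
  simp [linForm]

/-- Specialization at `z` of a polynomial whose coefficients are continuous functions. -/
noncomputable def specialize (z : EuclideanSpace ℝ (Fin n)) :
    MvPolynomial (Fin n) C(EuclideanSpace ℝ (Fin n), ℝ) →+* MvPolynomial (Fin n) ℝ :=
  MvPolynomial.map (ContinuousMap.evalAlgHom ℝ ℝ z).toRingHom

theorem specialize_C (z : EuclideanSpace ℝ (Fin n)) (f : C(EuclideanSpace ℝ (Fin n), ℝ)) :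
    specialize z (MvPolynomial.C f) = MvPolynomial.C (f z) := by
  simp [specialize]

theorem specialize_X (z : EuclideanSpace ℝ (Fin n)) (a : Fin n) :
    specialize z (MvPolynomial.X a) = MvPolynomial.X a := by
  simp [specialize]

theorem specialize_eq_sum (Q : MvPolynomial (Fin n) C(EuclideanSpace ℝ (Fin n), ℝ))
    (z : EuclideanSpace ℝ (Fin n)) :
    specialize z Q = ∑ d ∈ Q.support, Q.coeff d z • MvPolynomial.monomial d 1 := by
  conv_lhs => rw [Q.as_sum, map_sum]
  refine Finset.sum_congr rfl fun d _ => ?_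
  simp [specialize, MvPolynomial.map_monomial, MvPolynomial.smul_monomial]

theorem continuous_pairing_specialize (u : SmoothFun n →ₗ[ℝ] 𝕜)
    (Q : MvPolynomial (Fin n) C(EuclideanSpace ℝ (Fin n), ℝ)) :
    Continuous fun z => u (polyFun n (specialize z Q)) := by
  simp only [specialize_eq_sum, map_sum, map_smul]
  exact continuous_finsetSum _ fun d _ => (map_continuous (Q.coeff d)).smul continuous_const

/-- Integrating a family of polynomials that depends continuously on a parameter gives a
polynomial, and this integration commutes with linear forms. -/
theorem exists_integral_specialize
    (Q : MvPolynomial (Fin n) C(EuclideanSpace ℝ (Fin n), ℝ))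
    {b : EuclideanSpace ℝ (Fin n) → ℝ} (hb : Continuous b) (hbc : HasCompactSupport b) :
    ∃ q : MvPolynomial (Fin n) ℝ,
      (∀ x : EuclideanSpace ℝ (Fin n), MvPolynomial.eval (fun a => x a) q =
        ∫ z, b z * MvPolynomial.eval (fun a => x a) (specialize z Q)) ∧
      ∀ u : SmoothFun n →ₗ[ℝ] 𝕜,
        u (polyFun n q) = ∫ z, b z • u (polyFun n (specialize z Q)) := by
  have hint : ∀ d, Integrable fun z => b z * Q.coeff d z := fun d =>
    (hb.mul (map_continuous (Q.coeff d))).integrable_of_hasCompactSupport hbc.mul_right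
  refine ⟨∑ d ∈ Q.support, (∫ z, b z * Q.coeff d z) • MvPolynomial.monomial d 1,
    fun x => ?_, fun u => ?_⟩
  · simp only [specialize_eq_sum, map_sum, MvPolynomial.smul_eval, Finset.mul_sum, ← mul_assoc]
    rw [integral_finsetSum _ fun d _ => (hint d).mul_const _]
    simp only [integral_mul_const]
  · simp only [specialize_eq_sum, map_sum, map_smul, Finset.smul_sum, smul_smul]
    rw [integral_finsetSum _ fun d _ => (hint d).smul_const _]
    simp only [integral_smul_const]

/-- Polynomials are spanned by the products of coordinates. -/
theorem pairing_polyFun_eq_zero (u : SmoothFun n →ₗ[ℝ] 𝕜)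
    (h : ∀ (l : ℕ) (J : Fin l → Fin n), u (polyFun n (∏ j, MvPolynomial.X (J j))) = 0)
    (q : MvPolynomial (Fin n) ℝ) : u (polyFun n q) = 0 := by
  have hmon : ∀ d : Fin n →₀ ℕ, u (polyFun n (MvPolynomial.monomial d 1)) = 0 := fun d => by
    -- Listing the variables of the monomial with multiplicity gives the tuple J.
    obtain ⟨L, hL⟩ : ∃ L : List (Fin n), (L : Multiset (Fin n)) = Finsupp.toMultiset d :=
      Quot.exists_rep _
    have h1 := h L.length L.get
    have h2 : ∏ j, (MvPolynomial.X (L.get j) : MvPolynomial (Fin n) ℝ) =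
        MvPolynomial.monomial d 1 := by
      have h3 : ∏ j, (MvPolynomial.X (L.get j) : MvPolynomial (Fin n) ℝ) =
          (L.map MvPolynomial.X).prod := by
        simp
      rw [h3, ← Multiset.prod_coe, ← Multiset.map_coe, hL, Finsupp.toMultiset_map,
        Finsupp.prod_toMultiset, Finsupp.prod_mapDomain_index (by simp) (by simp [pow_add]),
        MvPolynomial.monomial_eq, MvPolynomial.C_1, one_mul]
    rwa [h2] at h1
  rw [q.as_sum, map_sum, map_sum]
  refine Finset.sum_eq_zero fun d _ => ?_
  rw [show MvPolynomial.monomial d (q.coeff d) = q.coeff d • MvPolynomial.monomial d (1 : ℝ) by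
    simp [MvPolynomial.smul_monomial], map_smul, map_smul, hmon, smul_zero]

end PolynomialTestFunctions

/-! ### Polarization -/

/-- A symmetric tensor is determined by the associated form on real vectors. -/
theorem symmetric_tensor_eq_zero {𝕜 : Type*} [RCLike 𝕜] {n p : ℕ} (T : (Fin p → Fin n) → 𝕜)
    (hT : ∀ (σ : Equiv.Perm (Fin p)) (i : Fin p → Fin n), T (i ∘ σ) = T i)
    (h : ∀ v : EuclideanSpace ℝ (Fin n), ∑ i, (∏ j, v (i j)) • T i = 0) : T = 0 := by
  classical
  let P : MvPolynomial (Fin n) 𝕜 :=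
    ∑ i : Fin p → Fin n, MvPolynomial.C (T i) * ∏ j, MvPolynomial.X (i j)
  have hP : P = 0 := by
    -- Real points suffice even over ℂ: a polynomial vanishing on a product of infinite sets is
    -- zero.
    refine MvPolynomial.funext_set (fun _ => Set.range (RCLike.ofReal : ℝ → 𝕜))
      (fun _ => Set.infinite_range_of_injective RCLike.ofReal_injective) fun x hx => ?_
    choose v hv using fun a => hx a (Set.mem_univ a)
    have h1 := h (WithLp.toLp 2 v)
    simp only [P, map_sum, map_mul, MvPolynomial.eval_C, map_prod, MvPolynomial.eval_X, map_zero]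
    rw [← h1]
    refine Finset.sum_congr rfl fun i _ => ?_
    rw [RCLike.real_smul_eq_coe_mul, mul_comm]
    simp [← hv]
  funext i₀
  let d : (Fin p → Fin n) → (Fin n →₀ ℕ) := fun i => ∑ j, Finsupp.single (i j) 1
  have hd : ∀ i, d i = d i₀ → T i = T i₀ := fun i hi => by
    have hcount : ∀ a, (Finset.univ.filter fun j => i j = a).card =
        (Finset.univ.filter fun j => i₀ j = a).card := fun a => by
      have := DFunLike.congr_fun hi a
      simpa [d, Finsupp.finsetSum_apply, Finsupp.single_apply] using this
    have e : ∀ a, Nonempty ({j // i₀ j = a} ≃ {j // i j = a}) := fun a =>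
      Fintype.card_eq.1 (by rw [Fintype.card_subtype, Fintype.card_subtype, hcount])
    -- Two tuples with the same multiplicities differ by a permutation, obtained by matching their
    -- fibers value by value.
    let σ : Equiv.Perm (Fin p) := (Equiv.sigmaFiberEquiv i₀).symm.trans
      ((Equiv.sigmaCongrRight fun a => (e a).some).trans (Equiv.sigmaFiberEquiv i))
    have hσ : i ∘ σ = i₀ := funext fun j => by
      simp only [σ, Function.comp_apply, Equiv.trans_apply]
      exact ((e (i₀ j)).some ⟨j, rfl⟩).2
    rw [← hT σ i, hσ]
  -- This coefficient of P is T i₀ times the number of rearrangements of i₀, a positive integer.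
  have hcoeff : ∑ i ∈ Finset.univ.filter (fun i => d i = d i₀), T i = 0 := by
    have h1 := congrArg (MvPolynomial.coeff (d i₀)) hP
    have h2 : ∀ i : Fin p → Fin n, (∏ j, MvPolynomial.X (i j) : MvPolynomial (Fin n) 𝕜) =
        MvPolynomial.monomial (d i) 1 := fun i => by
      simp only [d, MvPolynomial.monomial_sum_one, MvPolynomial.X]
    simpa [P, h2, MvPolynomial.coeff_sum, MvPolynomial.coeff_C_mul, MvPolynomial.coeff_monomial,
      Finset.sum_filter] using h1
  rw [Finset.sum_congr rfl fun i hi => hd i (Finset.mem_filter.1 hi).2, Finset.sum_const,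
    nsmul_eq_mul, mul_eq_zero, Nat.cast_eq_zero, Finset.card_eq_zero] at hcoeff
  rcases hcoeff with h1 | h1
  · exact absurd rfl (Finset.filter_eq_empty_iff.1 h1 (Finset.mem_univ i₀))
  · exact h1

/-! ### Density of polynomials -/

section Density

variable {n : ℕ}

/-- The normalized Landau kernel on the ball of radius `R`. -/
noncomputable def landauKernel (n : ℕ) (R : ℝ) (s : ℕ) : EuclideanSpace ℝ (Fin n) → ℝ :=
  (Metric.closedBall 0 R).indicator fun z =>
    (∫ w in Metric.closedBall (0 : EuclideanSpace ℝ (Fin n)) R, (1 - ‖w‖ ^ 2 / R ^ 2) ^ s)⁻¹ *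
      (1 - ‖z‖ ^ 2 / R ^ 2) ^ s

theorem integrable_landauKernel (R : ℝ) (s : ℕ) : Integrable (landauKernel n R s) := by
  rw [landauKernel, integrable_indicator_iff measurableSet_closedBall]
  exact (Continuous.continuousOn (by fun_prop)).integrableOn_compact (isCompact_closedBall _ _)

/-- The average `∫ k(z) g(x - z) dz`. -/
noncomputable def kernelAverage {G : Type} [NormedAddCommGroup G] [NormedSpace ℝ G]
    (k : EuclideanSpace ℝ (Fin n) → ℝ) (g : EuclideanSpace ℝ (Fin n) → G)
    (x : EuclideanSpace ℝ (Fin n)) : G :=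
  ∫ z, k z • g (x - z)

theorem hasFDerivAt_kernelAverage {G : Type} [NormedAddCommGroup G] [NormedSpace ℝ G]
    {k : EuclideanSpace ℝ (Fin n) → ℝ} (hk : LocallyIntegrable k)
    {g : EuclideanSpace ℝ (Fin n) → G} (hg : ContDiff ℝ ∞ g) (hgc : HasCompactSupport g)
    (x : EuclideanSpace ℝ (Fin n)) :
    HasFDerivAt (kernelAverage k g) (kernelAverage k (fderiv ℝ g) x) x :=
  hgc.hasFDerivAt_convolution_right (ContinuousLinearMap.lsmul ℝ ℝ) hk (hg.of_le (by simp)) x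

theorem contDiff_kernelAverage {G : Type} [NormedAddCommGroup G] [NormedSpace ℝ G]
    {k : EuclideanSpace ℝ (Fin n) → ℝ} (hk : LocallyIntegrable k)
    {g : EuclideanSpace ℝ (Fin n) → G} (hg : ContDiff ℝ ∞ g) (hgc : HasCompactSupport g) :
    ContDiff ℝ ∞ (kernelAverage k g) :=
  hgc.contDiff_convolution_right (n := ⊤) (ContinuousLinearMap.lsmul ℝ ℝ) hk hg

/-- The powers of 1 - ‖z‖²/R² concentrate at their unique maximum z = 0. Applying this peak
principle to z ↦ g(· - z) with values in C(K, G) makes the convergence uniform on K. -/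
theorem eventually_norm_landau_sub_le {G : Type} [NormedAddCommGroup G] [NormedSpace ℝ G]
    [CompleteSpace G] {R : ℝ} (hR : 0 < R) {g : EuclideanSpace ℝ (Fin n) → G} (hg : Continuous g)
    {K : Set (EuclideanSpace ℝ (Fin n))} (hK : IsCompact K) {ε : ℝ} (hε : 0 < ε) :
    ∀ᶠ s in Filter.atTop, ∀ x ∈ K, ‖kernelAverage (landauKernel n R s) g x - g x‖ ≤ ε := by
  have := isCompact_iff_compactSpace.1 hK
  let Φ : C(EuclideanSpace ℝ (Fin n), C(K, G)) :=
    ContinuousMap.curry ⟨fun q => g (q.2 - q.1), by fun_prop⟩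
  have hΦ : ∀ z (x : K), Φ z x = g (x - z) := fun _ _ => rfl
  have hball := isCompact_closedBall (0 : EuclideanSpace ℝ (Fin n)) R
  have hlim := tendsto_setIntegral_pow_smul_of_unique_maximum_of_isCompact_of_continuousOn
    (μ := volume) (x₀ := (0 : EuclideanSpace ℝ (Fin n))) (g := Φ)
    (c := fun z => 1 - ‖z‖ ^ 2 / R ^ 2) hball (Continuous.continuousOn (by fun_prop))
    (fun y _ hy => by have := norm_pos_iff.2 hy; simp; positivity)
    (fun y hy => by
      have : ‖y‖ ≤ R := mem_closedBall_zero_iff.1 hy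
      rw [sub_nonneg, div_le_one (by positivity)]
      gcongr)
    (by simp) (by rw [interior_closedBall _ hR.ne', closure_ball _ hR.ne']; simp [hR.le])
    Φ.continuous.continuousOn
  filter_upwards [Metric.tendsto_nhds.1 hlim ε hε] with s hs x hx
  rw [dist_eq_norm] at hs
  have h1 := (ContinuousMap.norm_coe_le_norm _ (⟨x, hx⟩ : K)).trans hs.le
  refine le_of_eq_of_le (congrArg norm ?_) h1
  rw [ContinuousMap.sub_apply, ContinuousMap.smul_apply, hΦ, sub_zero]
  congr 1
  have hint : IntegrableOn (fun z => (1 - ‖z‖ ^ 2 / R ^ 2) ^ s • Φ z) (Metric.closedBall 0 R) :=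
    (Continuous.continuousOn (by fun_prop)).integrableOn_compact hball
  have h2 := (ContinuousMap.evalCLM ℝ (⟨x, hx⟩ : K)).integral_comp_comm hint
  simp only [ContinuousMap.evalCLM_apply, ContinuousMap.smul_apply, hΦ] at h2
  rw [← h2, ← integral_smul, ← integral_indicator measurableSet_closedBall, kernelAverage]
  refine integral_congr_ae (Filter.Eventually.of_forall fun z => ?_)
  by_cases hz : z ∈ Metric.closedBall (0 : EuclideanSpace ℝ (Fin n)) R
  · simp only [landauKernel, Set.indicator_of_mem hz, smul_smul]
  · simp only [landauKernel, Set.indicator_of_notMem hz, zero_smul]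

/-- Differentiation passes through the average onto g, so order j + 1 for g is order j for `fderiv ℝ
g`; hence the target space must vary in the induction. -/
theorem eventually_norm_iteratedFDeriv_landau_sub_le {R : ℝ} (hR : 0 < R)
    {K : Set (EuclideanSpace ℝ (Fin n))} (hK : IsCompact K) {ε : ℝ} (hε : 0 < ε) (j : ℕ) :
    ∀ {G : Type} [NormedAddCommGroup G] [NormedSpace ℝ G] [CompleteSpace G]
      {g : EuclideanSpace ℝ (Fin n) → G}, ContDiff ℝ ∞ g → HasCompactSupport g →
      ∀ᶠ s in Filter.atTop, ∀ x ∈ K,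
        ‖iteratedFDeriv ℝ j (kernelAverage (landauKernel n R s) g - g) x‖ ≤ ε := by
  induction j with
  | zero =>
    intro G _ _ _ g hg hgc
    simpa only [norm_iteratedFDeriv_zero, Pi.sub_apply] using
      eventually_norm_landau_sub_le hR hg.continuous hK hε
  | succ j ih =>
    intro G _ _ _ g hg hgc
    filter_upwards [ih (hg.fderiv_right (m := ∞) (by simp)) (hgc.fderiv ℝ)] with s hs x hx
    rw [← norm_iteratedFDeriv_fderiv]
    convert hs x hx using 3
    funext y
    exact ((hasFDerivAt_kernelAverage (integrable_landauKernel R s).locallyIntegrable hg hgc y).sub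
      (hg.differentiable (by simp) y).hasFDerivAt).fderiv

variable {𝕜 : Type*} [RCLike 𝕜]

/-- A compactly supported distribution only sees the values of a test function on some ball. -/
theorem exists_pairing_congr (u : CompactDistribution 𝕜 n) :
    ∃ R : ℝ, ∀ φ ψ : SmoothFun n, (∀ x, ‖x‖ < R → φ.1 x = ψ.1 x) → u.1 φ = u.1 ψ := by
  obtain ⟨K, N, C, hK, hC, hu⟩ := u.2
  obtain ⟨R, hR⟩ := hK.isBounded.subset_ball 0
  refine ⟨R, fun φ ψ h => ?_⟩
  -- All derivatives of the difference vanish on K, so the seminorm bound can be taken to be 0.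
  have h1 := hu (φ - ψ) 0 le_rfl fun j _ x hx => ?_
  · rw [mul_zero, norm_le_zero_iff, map_sub, sub_eq_zero] at h1
    exact h1
  · have h2 : (φ - ψ).1 =ᶠ[nhds x] fun _ => 0 :=
      Filter.mem_of_superset (Metric.isOpen_ball.mem_nhds (hR hx)) fun y hy => by
        simp [h y (mem_ball_zero_iff.1 hy)]
    rw [(h2.iteratedFDeriv ℝ j).eq_of_nhds]
    have h3 : iteratedFDeriv ℝ j (fun _ : EuclideanSpace ℝ (Fin n) => (0 : ℝ)) = 0 :=
      iteratedFDeriv_fun_zero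
    simp [h3]

theorem exists_smooth_cutoff {V : Type*} [NormedAddCommGroup V] [InnerProductSpace ℝ V]
    [FiniteDimensional ℝ V] (R : ℝ) :
    ∃ χ : V → ℝ, ContDiff ℝ ∞ χ ∧ HasCompactSupport χ ∧ ∀ x, ‖x‖ ≤ R → χ x = 1 := by
  let f : ContDiffBump (0 : V) := ⟨|R| + 1, |R| + 2, by positivity, by linarith⟩
  exact ⟨f, f.contDiff, f.hasCompactSupport, fun x hx => f.one_of_mem_closedBall
    (mem_closedBall_zero_iff.2 (hx.trans ((le_abs_self R).trans (by simp [f]))))⟩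

/-- Convolution with the Landau kernel agrees with a polynomial on bounded sets. -/
theorem exists_landau_eq_integral (R : ℝ) (s : ℕ) :
    ∃ (c : ℝ) (Q : MvPolynomial (Fin n) C(EuclideanSpace ℝ (Fin n), ℝ)),
      ∀ x z : EuclideanSpace ℝ (Fin n), ‖x - z‖ ≤ R →
        landauKernel n R s (x - z) = c * MvPolynomial.eval (fun a => x a) (specialize z Q) := by
  refine ⟨(∫ w in Metric.closedBall (0 : EuclideanSpace ℝ (Fin n)) R,
    (1 - ‖w‖ ^ 2 / R ^ 2) ^ s)⁻¹, (1 - MvPolynomial.C (ContinuousMap.const _ (R ^ 2)⁻¹) *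
    ∑ a, (MvPolynomial.X a - MvPolynomial.C ⟨fun z => z a, by fun_prop⟩) ^ 2) ^ s,
    fun x z hxz => ?_⟩
  rw [landauKernel, Set.indicator_of_mem (mem_closedBall_zero_iff.2 hxz)]
  congr 1
  simp only [map_pow, map_sub, map_one, map_mul, map_sum, specialize_C, specialize_X,
    MvPolynomial.eval_C, MvPolynomial.eval_X, ContinuousMap.const_apply, ContinuousMap.coe_mk]
  rw [EuclideanSpace.norm_sq_eq, div_eq_inv_mul]
  simp

/-- A compactly supported distribution that vanishes on polynomials is zero. -/
theorem compactDistribution_eq_zero (u : CompactDistribution 𝕜 n)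
    (hu : ∀ q, u.1 (polyFun n q) = 0) : u = 0 := by
  refine Subtype.ext (LinearMap.ext fun φ => ?_)
  obtain ⟨R₀, hR₀⟩ := exists_pairing_congr u
  obtain ⟨K, N, C, hK, hC, hest⟩ := u.2
  obtain ⟨χ, hχ, hχc, hχ1⟩ := exists_smooth_cutoff (V := EuclideanSpace ℝ (Fin n)) R₀
  let φ' : SmoothFun n := ⟨fun x => χ x * φ.1 x, hχ.mul φ.2⟩
  have hφ'c : HasCompactSupport φ'.1 := hχc.mul_right
  have hφ'd : ContDiff ℝ ∞ φ'.1 := φ'.2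
  rw [hR₀ φ φ' fun x hx => by simp [φ', hχ1 x hx.le]]
  obtain ⟨R₁, hR₁⟩ := hφ'c.isCompact.isBounded.exists_norm_le
  -- For ‖x‖ < R₀ and z in the support of φ', this ensures ‖x - z‖ ≤ R, where the kernel is a
  -- polynomial.
  let R := |R₀| + |R₁| + 1
  have hR : 0 < R := by positivity
  let S : ℕ → SmoothFun n := fun s => ⟨kernelAverage (landauKernel n R s) φ'.1,
    contDiff_kernelAverage (integrable_landauKernel R s).locallyIntegrable hφ'd hφ'c⟩
  have hS : ∀ s, u.1 (S s) = 0 := fun s => by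
    obtain ⟨c, Q, hQ⟩ := exists_landau_eq_integral (n := n) R s
    obtain ⟨q, hq, -⟩ := exists_integral_specialize (𝕜 := 𝕜) Q
      (b := fun z => c * φ'.1 z) (continuous_const.mul hφ'd.continuous) hφ'c.mul_left
    rw [← hu q]
    refine hR₀ _ _ fun x hx => ?_
    rw [polyFun_apply, hq]
    change ∫ z, landauKernel n R s z • φ'.1 (x - z) = _
    rw [← integral_sub_left_eq_self _ _ x]
    refine integral_congr_ae (Filter.Eventually.of_forall fun z => ?_)
    simp only [sub_sub_cancel, smul_eq_mul]
    by_cases hz : φ'.1 z = 0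
    · simp [hz]
    · have hz' := hR₁ z (subset_tsupport _ hz)
      rw [hQ x z ((norm_sub_le _ _).trans (by
        have := le_abs_self R₀; have := le_abs_self R₁; simp only [R]; linarith))]
      ring
  refine norm_le_zero_iff.1 (le_of_forall_pos_le_add fun ε hε => ?_)
  rw [zero_add]
  -- The 1 is added because C may be 0.
  have hδ : 0 < ε / (C + 1) := by positivity
  have hev : ∀ᶠ s in Filter.atTop, ∀ j ∈ Finset.range (N + 1), ∀ x ∈ K,
      ‖iteratedFDeriv ℝ j (kernelAverage (landauKernel n R s) φ'.1 - φ'.1) x‖ ≤ ε / (C + 1) :=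
    (Filter.eventually_all_finset _).2 fun j _ =>
      eventually_norm_iteratedFDeriv_landau_sub_le hR hK hδ j hφ'd hφ'c
  obtain ⟨s, hs⟩ := hev.exists
  have h1 := hest (S s - φ') _ hδ.le fun j hj x hx =>
    hs j (Finset.mem_range.2 (Nat.lt_succ_of_le hj)) x hx
  rw [map_sub, hS, zero_sub, norm_neg] at h1
  refine h1.trans ?_
  rw [mul_div_assoc', div_le_iff₀ (by positivity)]
  nlinarith

end Density

/-! ### Contraction of a family of linear forms with a direction -/

section Contraction

variable {n : ℕ} {𝕜 : Type*} [RCLike 𝕜] {κ : Type*} [Fintype κ]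

/-- The linear form `q ↦ ∑ᵣ ξ^{i(r)} u_r(q)` on polynomials. -/
noncomputable def contraction (d : κ → ℕ) (i : ∀ r, Fin (d r) → Fin n)
    (u : κ → SmoothFun n →ₗ[ℝ] 𝕜) (ξ : EuclideanSpace ℝ (Fin n)) :
    MvPolynomial (Fin n) ℝ →ₗ[ℝ] 𝕜 :=
  ∑ r, (∏ j, ξ (i r j)) • (u r ∘ₗ polyFun n)

theorem contraction_apply (d : κ → ℕ) (i : ∀ r, Fin (d r) → Fin n)
    (u : κ → SmoothFun n →ₗ[ℝ] 𝕜) (ξ : EuclideanSpace ℝ (Fin n)) (q : MvPolynomial (Fin n) ℝ) :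
    contraction d i u ξ q = ∑ r, (∏ j, ξ (i r j)) • u r (polyFun n q) := by
  simp [contraction]

theorem continuous_contraction_specialize (d : κ → ℕ) (i : ∀ r, Fin (d r) → Fin n)
    (u : κ → SmoothFun n →ₗ[ℝ] 𝕜) (Q : MvPolynomial (Fin n) C(EuclideanSpace ℝ (Fin n), ℝ)) :
    Continuous fun ξ => contraction d i u ξ (specialize ξ Q) := by
  simp only [contraction_apply]
  exact continuous_finsetSum _ fun r _ =>
    Continuous.smul (by fun_prop) (continuous_pairing_specialize (u r) Q)

/-- The multiple `‖ξ‖² y - ⟪y, ξ⟫ ξ` of the component of `y` orthogonal to `ξ`. -/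
noncomputable def perp (y ξ : EuclideanSpace ℝ (Fin n)) : EuclideanSpace ℝ (Fin n) :=
  ‖ξ‖ ^ 2 • y - inner ℝ y ξ • ξ

theorem inner_perp_self (y ξ : EuclideanSpace ℝ (Fin n)) : inner ℝ (perp y ξ) ξ = 0 := by
  rw [perp, inner_sub_left, real_inner_smul_left, real_inner_smul_left, real_inner_self_eq_norm_sq]
  ring

theorem contDiff_perp (y : EuclideanSpace ℝ (Fin n)) : ContDiff ℝ ∞ (perp y) := by
  unfold perp
  exact ((contDiff_id.norm_sq ℝ).smul contDiff_const).sub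
    ((contDiff_const.inner ℝ contDiff_id).smul contDiff_id)

/-- The linear form `∑ vₐ(z) Xₐ` with continuous coefficients. -/
noncomputable def linFormFamily (v : C(EuclideanSpace ℝ (Fin n), EuclideanSpace ℝ (Fin n))) :
    MvPolynomial (Fin n) C(EuclideanSpace ℝ (Fin n), ℝ) :=
  ∑ a, MvPolynomial.C ⟨fun z => v z a, by fun_prop⟩ * MvPolynomial.X a

theorem specialize_linFormFamily
    (v : C(EuclideanSpace ℝ (Fin n), EuclideanSpace ℝ (Fin n))) (z : EuclideanSpace ℝ (Fin n)) :
    specialize z (linFormFamily v) = linForm (v z) := by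
  simp [linFormFamily, linForm, specialize_C, specialize_X]

/-- The polynomials `⟪ξ, x⟫^k ⟪perp y ξ, x⟫^l` in `x`, as a family depending on `ξ`. -/
noncomputable def ridgeFamily (y : EuclideanSpace ℝ (Fin n)) (k l : ℕ) :
    MvPolynomial (Fin n) C(EuclideanSpace ℝ (Fin n), ℝ) :=
  linFormFamily (ContinuousMap.id _) ^ k *
    linFormFamily ⟨perp y, (contDiff_perp y).continuous⟩ ^ l

theorem specialize_ridgeFamily (y ξ : EuclideanSpace ℝ (Fin n)) (k l : ℕ) :
    specialize ξ (ridgeFamily y k l) = linForm ξ ^ k * linForm (perp y ξ) ^ l := by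
  simp [ridgeFamily, specialize_linFormFamily]

theorem C_norm_sq_mul_linForm (y ξ : EuclideanSpace ℝ (Fin n)) :
    MvPolynomial.C (‖ξ‖ ^ 2) * linForm y =
      MvPolynomial.C (inner ℝ y ξ) * linForm ξ + linForm (perp y ξ) := by
  rw [← linForm_smul, ← linForm_smul, ← linForm_add, perp, add_sub_cancel]

/-- This splits powers of ⟪y, x⟫ into ridge products: those with j ≤ m will be annihilated, the
others are divisible by ⟪y, ξ⟫^{m+1}. -/
theorem norm_pow_smul_linForm_pow (y ξ : EuclideanSpace ℝ (Fin n)) (l : ℕ) :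
    (‖ξ‖ ^ 2) ^ l • linForm y ^ l = ∑ j ∈ Finset.range (l + 1),
      (inner ℝ y ξ ^ j * (l.choose j : ℝ)) • (linForm ξ ^ j * linForm (perp y ξ) ^ (l - j)) := by
  rw [MvPolynomial.smul_eq_C_mul, map_pow, ← mul_pow, C_norm_sq_mul_linForm, add_pow]
  refine Finset.sum_congr rfl fun j _ => ?_
  rw [MvPolynomial.smul_eq_C_mul, mul_pow, map_mul, map_pow, map_natCast]
  ring

/-- A polynomial of degree at most `m` that vanishes to order `m + 1` at `0` is zero. -/
theorem polynomial_eq_zero_of_order {m : ℕ} {P : Polynomial 𝕜} (hP : P.natDegree ≤ m)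
    {a : ℝ → ℝ} {g : ℝ → 𝕜} (ha : Continuous a) (ha0 : a 0 ≠ 0) (hg : Continuous g)
    (h : ∀ s : ℝ, a s • P.eval (s : 𝕜) = s ^ (m + 1) • g s) : P = 0 := by
  have hdvd : ∀ k ≤ m + 1, (Polynomial.X : Polynomial 𝕜) ^ k ∣ P := by
    intro k
    induction k with
    | zero => simp
    | succ k ih =>
      intro hk
      obtain ⟨T, hT⟩ := ih (by omega)
      have hcont : Continuous fun s : ℝ => T.eval (s : 𝕜) :=
        T.continuous.comp RCLike.continuous_ofReal
      -- Cancel s^k for s ≠ 0 and extend to s = 0 by continuity. As k ≤ m, the right side vanishes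
      -- at 0, which forces T(0) = 0 and one more factor X.
      have heq : (fun s : ℝ => a s • T.eval (s : 𝕜)) = fun s => s ^ (m + 1 - k) • g s := by
        refine Continuous.ext_on (dense_compl_singleton (0 : ℝ)) (ha.smul hcont)
          ((continuous_pow _).smul hg) fun s hs => ?_
        have h1 := h s
        rw [hT, Polynomial.eval_mul, Polynomial.eval_pow, Polynomial.eval_X,
          show m + 1 = k + (m + 1 - k) by omega, pow_add, mul_smul, ← RCLike.ofReal_pow,
          ← RCLike.real_smul_eq_coe_mul, smul_comm] at h1
        have h2 := smul_right_injective 𝕜 (pow_ne_zero k hs) h1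
        simpa using h2
      have h0 := congrFun heq 0
      simp only [zero_pow (show m + 1 - k ≠ 0 by omega), zero_smul, RCLike.ofReal_zero,
        smul_eq_zero, ha0, false_or] at h0
      obtain ⟨T', hT'⟩ := Polynomial.X_dvd_iff.2 (T.coeff_zero_eq_eval_zero.trans h0)
      exact ⟨T', by rw [hT, hT', pow_succ, mul_assoc]⟩
  refine Polynomial.eq_zero_of_dvd_of_natDegree_lt (hdvd (m + 1) le_rfl) ?_
  rw [Polynomial.natDegree_X_pow]
  omega

theorem exists_ne_zero_inner_eq_zero (hn : 2 ≤ n) (y : EuclideanSpace ℝ (Fin n)) :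
    ∃ η : EuclideanSpace ℝ (Fin n), η ≠ 0 ∧ inner ℝ y η = 0 := by
  have h : (ℝ ∙ y)ᗮ ≠ ⊥ := fun h => by
    have h1 := Submodule.finrank_add_finrank_orthogonal (ℝ ∙ y)
    have h2 := finrank_span_le_card (R := ℝ) ({y} : Set (EuclideanSpace ℝ (Fin n)))
    rw [Set.toFinset_card, Fintype.card_unique] at h2
    rw [h, finrank_bot, finrank_euclideanSpace_fin] at h1
    omega
  obtain ⟨η, hη, hη0⟩ := Submodule.exists_mem_ne_zero_of_ne_bot h
  exact ⟨η, hη0, Submodule.mem_orthogonal_singleton_iff_inner_right.1 hη⟩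

variable {d : κ → ℕ} {i : ∀ r, Fin (d r) → Fin n} {u : κ → SmoothFun n →ₗ[ℝ] 𝕜} {m : ℕ}

/-- Along ξ = η + s y one has ⟪y, ξ⟫ = s ‖y‖², so the terms left in the binomial expansion are
divisible by s^{m+1}, while the contraction has degree at most m in s. Orthogonality and η ≠ 0 keep
the line away from the origin. -/
theorem contraction_linForm_pow_of_inner_eq_zero (hd : ∀ r, d r ≤ m)
    (h : ∀ k ≤ m, ∀ (l : ℕ) (y ξ : EuclideanSpace ℝ (Fin n)), ξ ≠ 0 →
      contraction d i u ξ (linForm ξ ^ k * linForm (perp y ξ) ^ l) = 0)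
    (l : ℕ) {y η : EuclideanSpace ℝ (Fin n)} (hη : η ≠ 0) (hyη : inner ℝ y η = 0) (s : ℝ) :
    contraction d i u (η + s • y) (linForm y ^ l) = 0 := by
  let P : Polynomial 𝕜 := ∑ r, Polynomial.C (u r (polyFun n (linForm y ^ l))) *
    ∏ j, (Polynomial.C (y (i r j) : 𝕜) * Polynomial.X + Polynomial.C (η (i r j) : 𝕜))
  have hP : ∀ s : ℝ, P.eval (s : 𝕜) = contraction d i u (η + s • y) (linForm y ^ l) := fun s => by
    rw [contraction_apply, Polynomial.eval_finsetSum]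
    refine Finset.sum_congr rfl fun r _ => ?_
    rw [RCLike.real_smul_eq_coe_mul, Polynomial.eval_mul, Polynomial.eval_prod, mul_comm,
      Polynomial.eval_C]
    congr 1
    rw [RCLike.ofReal_prod]
    refine Finset.prod_congr rfl fun j _ => ?_
    simp only [Polynomial.eval_add, Polynomial.eval_mul, Polynomial.eval_C, Polynomial.eval_X,
      PiLp.add_apply, PiLp.smul_apply, smul_eq_mul, RCLike.ofReal_add, RCLike.ofReal_mul]
    ring
  have hdeg : P.natDegree ≤ m := by
    refine Polynomial.natDegree_sum_le_of_forall_le _ _ fun r _ => ?_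
    refine (Polynomial.natDegree_C_mul_le _ _).trans ((Polynomial.natDegree_prod_le _ _).trans ?_)
    refine (Finset.sum_le_card_nsmul _ _ 1 fun j _ => Polynomial.natDegree_linear_le).trans ?_
    simpa using hd r
  have hinner : ∀ s : ℝ, inner ℝ y (η + s • y) = s * ‖y‖ ^ 2 := fun s => by
    rw [inner_add_right, hyη, zero_add, real_inner_smul_right, real_inner_self_eq_norm_sq]
  have hne : ∀ s : ℝ, η + s • y ≠ 0 := fun s h0 => by
    have h1 : inner ℝ η (η + s • y) = ‖η‖ ^ 2 := by
      rw [inner_add_right, real_inner_smul_right, real_inner_comm y η, hyη,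
        real_inner_self_eq_norm_sq]
      ring
    rw [h0, inner_zero_right] at h1
    exact hη (norm_eq_zero.1 (pow_eq_zero_iff two_ne_zero |>.1 h1.symm))
  have hline : Continuous fun s : ℝ => η + s • y := by fun_prop
  have hP0 : P = 0 := by
    refine polynomial_eq_zero_of_order hdeg (a := fun s => (‖η + s • y‖ ^ 2) ^ l)
      -- The terms with j > m, with the factor s^{m+1} taken out.
      (g := fun s => ∑ j ∈ Finset.range (l + 1), if j ≤ m then 0 else
        (s ^ (j - (m + 1)) * (‖y‖ ^ 2) ^ j * (l.choose j : ℝ)) • contraction d i u (η + s • y)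
          (specialize (η + s • y) (ridgeFamily y j (l - j))))
      (by fun_prop) (pow_ne_zero _ (pow_ne_zero _ (norm_ne_zero_iff.2 (hne 0)))) ?_ fun s => ?_
    · refine continuous_finsetSum _ fun j _ => ?_
      split_ifs
      · exact continuous_const
      · exact Continuous.smul (by fun_prop)
          ((continuous_contraction_specialize d i u (ridgeFamily y j (l - j))).comp hline)
    · rw [hP, ← map_smul, norm_pow_smul_linForm_pow, map_sum, Finset.smul_sum]
      refine Finset.sum_congr rfl fun j _ => ?_
      rw [map_smul]
      split_ifs with hj
      · rw [h j hj _ _ _ (hne s), smul_zero, smul_zero]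
      · rw [specialize_ridgeFamily, smul_smul, hinner, mul_pow]
        congr 1
        rw [show s ^ j = s ^ (m + 1) * s ^ (j - (m + 1)) by rw [← pow_add]; congr 1; omega]
        ring
  rw [← hP, hP0, Polynomial.eval_zero]

theorem contraction_linForm_pow_eq_zero (hn : 2 ≤ n) (hd : ∀ r, d r ≤ m)
    (h : ∀ k ≤ m, ∀ (l : ℕ) (y ξ : EuclideanSpace ℝ (Fin n)), ξ ≠ 0 →
      contraction d i u ξ (linForm ξ ^ k * linForm (perp y ξ) ^ l) = 0)
    (l : ℕ) (y ξ : EuclideanSpace ℝ (Fin n)) :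
    contraction d i u ξ (linForm y ^ l) = 0 := by
  have hmain : ∀ y : EuclideanSpace ℝ (Fin n), y ≠ 0 → contraction d i u ξ (linForm y ^ l) = 0 := by
    intro y hy
    obtain ⟨η, hη, hyη⟩ := exists_ne_zero_inner_eq_zero hn y
    let s : ℝ := inner ℝ y ξ / ‖y‖ ^ 2
    let ζ := ξ - s • y
    have hζ : inner ℝ y ζ = 0 := by
      have hy' := norm_ne_zero_iff.2 hy
      simp only [ζ, s, inner_sub_right, real_inner_smul_right, real_inner_self_eq_norm_sq]
      field_simp
      ring
    by_cases hζ0 : ζ = 0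
    -- Here ξ is parallel to y: perturb it by t • η with η orthogonal to y, and let t tend to 0.
    · have hcont : Continuous fun t : ℝ => contraction d i u (ξ + t • η) (linForm y ^ l) := by
        simp only [contraction_apply]
        fun_prop
      have heq : (fun t : ℝ => contraction d i u (ξ + t • η) (linForm y ^ l)) = fun _ => 0 := by
        refine Continuous.ext_on (dense_compl_singleton (0 : ℝ)) hcont continuous_const
          fun t ht => ?_
        have h1 := contraction_linForm_pow_of_inner_eq_zero hd h l (y := y) (η := t • η)
          (smul_ne_zero ht hη) (by rw [real_inner_smul_right, hyη, mul_zero]) s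
        rwa [← sub_eq_zero.1 hζ0, add_comm] at h1
      simpa using congrFun heq 0
    · have h1 := contraction_linForm_pow_of_inner_eq_zero hd h l hζ0 hζ s
      rwa [sub_add_cancel] at h1
  by_cases hy : y = 0
  -- For l = 0 the power is 1 whatever y is, so a nonzero vector may replace y.
  · rcases Nat.eq_zero_or_pos l with rfl | hl
    · obtain ⟨η, hη, -⟩ := exists_ne_zero_inner_eq_zero hn y
      simpa using hmain η hη
    · rw [hy, linForm_zero, zero_pow hl.ne', map_zero]
  · exact hmain y hy

end Contraction

/-! ### Test functions concentrated near the hyperplanes `⟪x, ξ⟫ = 0` -/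

section HyperplaneTestFunctions

variable {n : ℕ}

/-- The product of b, ρ and h need not have compact support in x, so a cutoff χ(x) is inserted. It
is invisible on rays through the ball: where b and ρ are nonzero, ξ is bounded and bounded away from
0, so t • ξ is bounded. -/
theorem exists_testFunction_of_ray_invariant {b : EuclideanSpace ℝ (Fin n) → ℝ}
    (hb : ContDiff ℝ ∞ b) (hbc : HasCompactSupport b) (hb0 : tsupport b ⊆ {0}ᶜ)
    {ρ : ℝ → ℝ} (hρ : ContDiff ℝ ∞ ρ) (hρc : HasCompactSupport ρ)
    {h : EuclideanSpace ℝ (Fin n) × EuclideanSpace ℝ (Fin n) → ℝ} (hh : ContDiff ℝ ∞ h)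
    (hinv : ∀ (x ξ : EuclideanSpace ℝ (Fin n)) (t : ℝ), h (x - t • ξ, ξ) = h (x, ξ)) (R : ℝ) :
    ∃ ψ : 𝓓(nonzeroDirections n, ℝ), ∀ x : EuclideanSpace ℝ (Fin n), ‖x‖ < R →
      ∀ (ξ : EuclideanSpace ℝ (Fin n)) (t : ℝ),
        ψ (x - t • ξ, ξ) = b ξ * ρ (inner ℝ ξ x - ‖ξ‖ ^ 2 * t) * h (x, ξ) := by
  obtain ⟨M, hM⟩ := hbc.isCompact.isBounded.exists_norm_le
  obtain ⟨A, hA⟩ := hρc.isCompact.isBounded.exists_norm_le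
  obtain ⟨δ, hδ, hδb⟩ : ∃ δ : ℝ, 0 < δ ∧ ∀ ξ ∈ tsupport b, δ ≤ ‖ξ‖ := by
    rcases (tsupport b).eq_empty_or_nonempty with he | hne
    · exact ⟨1, one_pos, by simp [he]⟩
    · obtain ⟨ξ₀, hξ₀, hmin⟩ := hbc.isCompact.exists_isMinOn hne continuous_norm.continuousOn
      exact ⟨‖ξ₀‖, norm_pos_iff.2 (hb0 hξ₀), fun ξ hξ => isMinOn_iff.1 hmin ξ hξ⟩
  obtain ⟨χ, hχ, hχc, hχ1⟩ := exists_smooth_cutoff (V := EuclideanSpace ℝ (Fin n))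
    (R + (A + M * R) / δ)
  let f : EuclideanSpace ℝ (Fin n) × EuclideanSpace ℝ (Fin n) → ℝ := fun q =>
    b q.2 * ρ (inner ℝ q.2 q.1) * h q * χ q.1
  have hf : ContDiff ℝ ∞ f :=
    (((hb.comp contDiff_snd).mul (hρ.comp (contDiff_snd.inner ℝ contDiff_fst))).mul hh).mul
      (hχ.comp contDiff_fst)
  have hzero : ∀ q ∉ tsupport χ ×ˢ tsupport b, f q = 0 := fun q hq => by
    rw [Set.mem_prod, not_and_or] at hq
    rcases hq with hq | hq
    · simp [f, image_eq_zero_of_notMem_tsupport hq]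
    · simp [f, image_eq_zero_of_notMem_tsupport hq]
  have hcpt : IsCompact (tsupport χ ×ˢ tsupport b) := hχc.isCompact.prod hbc.isCompact
  have hsub : tsupport f ⊆ tsupport χ ×ˢ tsupport b :=
    closure_minimal (fun q hq => not_not.1 fun h' => hq (hzero q h')) hcpt.isClosed
  refine ⟨⟨f, hf, HasCompactSupport.intro hcpt hzero, fun q hq => hb0 (hsub hq).2⟩,
    fun x hx ξ t => ?_⟩
  change b ξ * ρ (inner ℝ ξ (x - t • ξ)) * h (x - t • ξ, ξ) * χ (x - t • ξ) = _
  rw [inner_sub_right, real_inner_smul_right, real_inner_self_eq_norm_sq, hinv, mul_comm t]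
  by_cases hbξ : b ξ = 0
  · simp [hbξ]
  by_cases hρξ : ρ (inner ℝ ξ x - ‖ξ‖ ^ 2 * t) = 0
  · simp [hρξ]
  have hξM := hM ξ (subset_tsupport _ hbξ)
  have hξδ := hδb ξ (subset_tsupport _ hbξ)
  have hρA := hA _ (subset_tsupport _ hρξ)
  have hR0 : 0 ≤ R := (norm_nonneg x).trans hx.le
  have hξpos : 0 < ‖ξ‖ := hδ.trans_le hξδ
  -- From |⟪ξ, x⟫| ≤ M R and |⟪ξ, x⟫ - ‖ξ‖² t| ≤ A; dividing by δ ≤ ‖ξ‖ explains the cutoff radius.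
  have h1 : ‖ξ‖ ^ 2 * |t| ≤ A + M * R := by
    have h2 : |‖ξ‖ ^ 2 * t| ≤ |inner ℝ ξ x| + |inner ℝ ξ x - ‖ξ‖ ^ 2 * t| := by
      have := abs_sub (inner ℝ ξ x) (inner ℝ ξ x - ‖ξ‖ ^ 2 * t)
      rwa [sub_sub_cancel] at this
    have h3 : |inner ℝ ξ x| ≤ M * R := (abs_real_inner_le_norm ξ x).trans
      (mul_le_mul hξM hx.le (norm_nonneg _) ((norm_nonneg _).trans hξM))
    rw [abs_mul, abs_of_nonneg (sq_nonneg ‖ξ‖)] at h2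
    rw [Real.norm_eq_abs] at hρA
    linarith
  have h4 : ‖t • ξ‖ ≤ (A + M * R) / δ := by
    rw [le_div_iff₀ hδ, norm_smul, Real.norm_eq_abs]
    calc |t| * ‖ξ‖ * δ ≤ |t| * ‖ξ‖ * ‖ξ‖ := by gcongr
      _ = ‖ξ‖ ^ 2 * |t| := by ring
      _ ≤ _ := h1
  rw [hχ1 _ ((norm_sub_le _ _).trans (add_le_add hx.le h4)), mul_one]

/-- Substitute v = c - a t and expand (c - v)^k. The coefficient of c^k is ∫ ρ, which makes the
later induction on k triangular. -/
theorem mul_integral_pow_mul_comp {ρ : ℝ → ℝ} (hρ : Continuous ρ) (hρc : HasCompactSupport ρ)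
    (k : ℕ) (c : ℝ) {a : ℝ} (ha : 0 < a) :
    a ^ (k + 1) * ∫ t : ℝ, t ^ k * ρ (c - a * t) =
      ∑ j ∈ Finset.range (k + 1), (k.choose j : ℝ) * (∫ v, (-v) ^ (k - j) * ρ v) * c ^ j := by
  have h1 : ∫ t : ℝ, (a * t) ^ k * ρ (c - a * t) = a⁻¹ * ∫ v, (c - v) ^ k * ρ v := by
    rw [Measure.integral_comp_mul_left (fun t => t ^ k * ρ (c - t)) a,
      abs_of_pos (inv_pos.2 ha), smul_eq_mul,
      ← integral_sub_left_eq_self (fun v => (c - v) ^ k * ρ v) volume c]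
    simp only [sub_sub_cancel]
  have h2 : a ^ (k + 1) * ∫ t : ℝ, t ^ k * ρ (c - a * t) = ∫ v, (c - v) ^ k * ρ v := by
    simp only [mul_pow, mul_assoc, integral_const_mul] at h1
    rw [pow_succ', mul_assoc, h1, mul_inv_cancel_left₀ ha.ne']
  rw [h2]
  simp only [sub_eq_add_neg, add_pow, Finset.sum_mul]
  rw [integral_finsetSum]
  · refine Finset.sum_congr rfl fun j _ => ?_
    rw [← integral_const_mul, ← integral_mul_const]
    exact integral_congr_ae (Filter.Eventually.of_forall fun v => by ring)
  · intro j _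
    exact Continuous.integrable_of_hasCompactSupport (by fun_prop) hρc.mul_left

/-- The adjoint transform of a suitable test function is an average of ridge polynomials. -/
theorem exists_testFunction_adjointMRT {b : EuclideanSpace ℝ (Fin n) → ℝ}
    (hb : ContDiff ℝ ∞ b) (hbc : HasCompactSupport b) (hb0 : tsupport b ⊆ {0}ᶜ)
    {ρ : ℝ → ℝ} (hρ : ContDiff ℝ ∞ ρ) (hρc : HasCompactSupport ρ)
    (y : EuclideanSpace ℝ (Fin n)) (k l : ℕ) (R : ℝ) :
    ∃ ψ : 𝓓(nonzeroDirections n, ℝ), ∀ {p : ℕ} (i : Fin p → Fin n)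
      (x : EuclideanSpace ℝ (Fin n)), ‖x‖ < R →
        (adjointMRT k i ψ).1 x = ∫ ξ, b ξ * ((∏ j, ξ (i j)) *
          ∑ j ∈ Finset.range (k + 1), (k.choose j : ℝ) * (∫ v, (-v) ^ (k - j) * ρ v) *
            (inner ℝ ξ x ^ j * inner ℝ (perp y ξ) x ^ l)) := by
  -- The weight cancels the powers of ‖ξ‖² produced by the substitution in t.
  have hb' : ContDiff ℝ ∞ fun ξ => (‖ξ‖ ^ 2) ^ (k + 1) * b ξ :=
    ((contDiff_id.norm_sq ℝ).pow _).mul hb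
  have hinner : ContDiff ℝ ∞ fun q : EuclideanSpace ℝ (Fin n) × EuclideanSpace ℝ (Fin n) =>
      inner ℝ (perp y q.2) q.1 ^ l :=
    (((contDiff_perp y).comp contDiff_snd).inner ℝ contDiff_fst).pow l
  obtain ⟨ψ, hψ⟩ := exists_testFunction_of_ray_invariant hb' hbc.mul_left
    ((tsupport_mul_subset_right).trans hb0) hρ hρc hinner
    (fun x ξ t => by
      simp only [inner_sub_right, real_inner_smul_right, inner_perp_self, mul_zero, sub_zero]) R
  refine ⟨ψ, fun i x hx => integral_congr_ae (Filter.Eventually.of_forall fun ξ => ?_)⟩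
  simp only [hψ x hx]
  by_cases hξ : ξ = 0
  · have : b ξ = 0 := image_eq_zero_of_notMem_tsupport fun h => hb0 h hξ
    simp [this]
  have h1 := mul_integral_pow_mul_comp hρ.continuous hρc k (inner ℝ ξ x)
    (a := ‖ξ‖ ^ 2) (by have := norm_pos_iff.2 hξ; positivity)
  have h2 : ∀ t : ℝ, t ^ k * (∏ j, ξ (i j)) * ((‖ξ‖ ^ 2) ^ (k + 1) * b ξ *
      ρ (inner ℝ ξ x - ‖ξ‖ ^ 2 * t) * inner ℝ (perp y ξ) x ^ l) =
      (b ξ * (∏ j, ξ (i j)) * inner ℝ (perp y ξ) x ^ l * (‖ξ‖ ^ 2) ^ (k + 1)) *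
        (t ^ k * ρ (inner ℝ ξ x - ‖ξ‖ ^ 2 * t)) := fun t => by ring
  simp only [h2]
  rw [integral_const_mul, mul_assoc, h1, mul_assoc, mul_assoc, Finset.mul_sum]
  congr 2
  exact Finset.sum_congr rfl fun j _ => by ring

end HyperplaneTestFunctions

/-! ### Vanishing of the contractions -/

section Vanishing

variable {n m : ℕ} {𝕜 : Type*} [RCLike 𝕜] {κ : Type*} [Fintype κ] {d : κ → ℕ}
  {i : ∀ r, Fin (d r) → Fin n} {u : κ → CompactDistribution 𝕜 n}

/-- If a transform of order `k` vanishes, then so does the corresponding combination of the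
contractions with ridge polynomials. -/
theorem sum_contraction_eq_zero {k : ℕ}
    (h : ∀ ψ : 𝓓(nonzeroDirections n, ℝ), ∑ r, (u r).1 (adjointMRT k (i r) ψ) = 0)
    {ρ : ℝ → ℝ} (hρ : ContDiff ℝ ∞ ρ) (hρc : HasCompactSupport ρ) (l : ℕ)
    (y ξ : EuclideanSpace ℝ (Fin n)) (hξ : ξ ≠ 0) :
    ∑ j ∈ Finset.range (k + 1), ((k.choose j : ℝ) * ∫ v, (-v) ^ (k - j) * ρ v) •
      contraction d i (fun r => (u r).1) ξ (linForm ξ ^ j * linForm (perp y ξ) ^ l) = 0 := by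
  let Q : MvPolynomial (Fin n) C(EuclideanSpace ℝ (Fin n), ℝ) :=
    ∑ j ∈ Finset.range (k + 1), MvPolynomial.C (ContinuousMap.const _
      ((k.choose j : ℝ) * ∫ v, (-v) ^ (k - j) * ρ v)) * ridgeFamily y j l
  -- The tensor factor ξ^{i(r)} is absorbed into the coefficients, so the pairing commutes with the
  -- integral over ξ.
  let Q' : κ → MvPolynomial (Fin n) C(EuclideanSpace ℝ (Fin n), ℝ) := fun r =>
    MvPolynomial.C ⟨fun ξ => ∏ j, ξ (i r j), by fun_prop⟩ * Q
  have hQ : ∀ ξ, specialize ξ Q = ∑ j ∈ Finset.range (k + 1),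
      ((k.choose j : ℝ) * ∫ v, (-v) ^ (k - j) * ρ v) •
        (linForm ξ ^ j * linForm (perp y ξ) ^ l) := fun ξ => by
    simp only [Q, map_sum, map_mul (specialize ξ), specialize_C, specialize_ridgeFamily,
      ContinuousMap.const_apply, MvPolynomial.smul_eq_C_mul]
  have hQ' : ∀ r ξ, specialize ξ (Q' r) = (∏ j, ξ (i r j)) • specialize ξ Q := fun r ξ => by
    simp only [Q', map_mul, specialize_C, ContinuousMap.coe_mk, MvPolynomial.smul_eq_C_mul]
  let H : EuclideanSpace ℝ (Fin n) → 𝕜 := fun ξ =>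
    contraction d i (fun r => (u r).1) ξ (specialize ξ Q)
  have hH : Continuous H := continuous_contraction_specialize d i _ Q
  have hint : ∀ b : EuclideanSpace ℝ (Fin n) → ℝ, ContDiff ℝ ∞ b → HasCompactSupport b →
      tsupport b ⊆ {0}ᶜ → ∫ ξ, b ξ • H ξ = 0 := by
    intro b hb hbc hb0
    choose R hR using fun r => exists_pairing_congr (u r)
    obtain ⟨R₀, hR₀⟩ := Finite.exists_le R
    obtain ⟨ψ, hψ⟩ := exists_testFunction_adjointMRT hb hbc hb0 hρ hρc y k l R₀
    have hr : ∀ r, (u r).1 (adjointMRT k (i r) ψ) =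
        ∫ ξ, b ξ • (u r).1 (polyFun n (specialize ξ (Q' r))) := fun r => by
      obtain ⟨q, hq, hqu⟩ := exists_integral_specialize (𝕜 := 𝕜) (Q' r) hb.continuous hbc
      rw [← hqu]
      refine hR r _ _ fun x hx => ?_
      rw [hψ (i r) x (hx.trans_le (hR₀ r)), polyFun_apply, hq]
      simp only [hQ', hQ, MvPolynomial.smul_eval, map_sum, map_mul, map_pow, eval_linForm]
    rw [← h ψ]
    simp only [hr]
    rw [← integral_finsetSum]
    · refine integral_congr_ae (Filter.Eventually.of_forall fun ξ => ?_)
      simp only [H, contraction_apply, hQ', map_smul, Finset.smul_sum]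
    · exact fun r _ => (hb.continuous.smul
        (continuous_pairing_specialize _ _)).integrable_of_hasCompactSupport hbc.smul_right
  -- As b is arbitrary off the origin, H vanishes almost everywhere there, hence everywhere there by
  -- continuity.
  have hae := isOpen_compl_singleton.ae_eq_zero_of_integral_contDiff_smul_eq_zero
    (hH.locallyIntegrable.locallyIntegrableOn _) hint
  have hzero : H ξ = 0 := Measure.eqOn_open_of_ae_eq (μ := volume) (g := fun _ => (0 : 𝕜))
    ((ae_restrict_iff' isOpen_compl_singleton.measurableSet).2 hae) isOpen_compl_singleton
    hH.continuousOn continuousOn_const hξ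
  simpa only [H, hQ, map_sum, map_smul] using hzero

/-- With a bump ρ of positive integral, the order-k relation is triangular: the terms j < k vanish
by strong induction, leaving the top term times ∫ ρ. -/
theorem contraction_ridge_eq_zero
    (h : ∀ k ≤ m, ∀ ψ : 𝓓(nonzeroDirections n, ℝ), ∑ r, (u r).1 (adjointMRT k (i r) ψ) = 0)
    (l : ℕ) (y ξ : EuclideanSpace ℝ (Fin n)) (hξ : ξ ≠ 0) (k : ℕ) (hk : k ≤ m) :
    contraction d i (fun r => (u r).1) ξ (linForm ξ ^ k * linForm (perp y ξ) ^ l) = 0 := by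
  let ρ : ContDiffBump (0 : ℝ) := default
  induction k using Nat.strong_induction_on with
  | _ k ih =>
    have h1 := sum_contraction_eq_zero (h k hk) ρ.contDiff ρ.hasCompactSupport l y ξ hξ
    rw [Finset.sum_range_succ, Finset.sum_eq_zero fun j hj => by
      rw [ih j (Finset.mem_range.1 hj) ((Finset.mem_range.1 hj).le.trans hk), smul_zero],
      zero_add, Nat.choose_self, Nat.cast_one, one_mul, Nat.sub_self] at h1
    simp only [pow_zero, one_mul] at h1
    exact (smul_eq_zero.1 h1).resolve_left ρ.integral_pos.ne'

end Vanishing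

/-! ### Separation of degrees, polarization and conclusion -/

/-- A sum of terms of distinct degrees in a real parameter vanishes only if each term does. -/
theorem eq_zero_of_sum_pow_smul_eq_zero {𝕜 : Type*} [RCLike 𝕜] {m : ℕ} (A : Fin (m + 1) → 𝕜)
    (h : ∀ c : ℝ, ∑ p : Fin (m + 1), c ^ (p : ℕ) • A p = 0) (p : Fin (m + 1)) : A p = 0 := by
  let P : Polynomial 𝕜 := ∑ p : Fin (m + 1), Polynomial.C (A p) * Polynomial.X ^ (p : ℕ)
  have hP : P = 0 := by
    refine Polynomial.eq_zero_of_infinite_isRoot P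
      ((Set.infinite_range_of_injective (RCLike.ofReal_injective (K := 𝕜))).mono ?_)
    rintro _ ⟨c, rfl⟩
    rw [Set.mem_ofPred_eq, Polynomial.IsRoot.def, ← h c, Polynomial.eval_finsetSum]
    refine Finset.sum_congr rfl fun p _ => ?_
    rw [RCLike.real_smul_eq_coe_mul, mul_comm (RCLike.ofReal _), Polynomial.eval_mul, Polynomial.eval_C,
      Polynomial.eval_pow, Polynomial.eval_X, RCLike.ofReal_pow]
  have h1 := congrArg (fun P => P.coeff (p : ℕ)) hP
  simpa [P, Polynomial.finsetSum_coeff, Polynomial.coeff_X_pow, Fin.val_inj] using h1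

theorem generalizedMRT_apply {𝕜 : Type*} [RCLike 𝕜] {n m : ℕ} (k : ℕ)
    (F : TensorSumDistribution 𝕜 n m) (ψ : 𝓓(nonzeroDirections n, ℝ)) :
    generalizedMRT k F ψ =
      ∑ r : (p : Fin (m + 1)) × (Fin p → Fin n), ((F r.1).1 r.2).1 (adjointMRT k r.2 ψ) := by
  rw [Fintype.sum_sigma, generalizedMRT]
  simp only [momentumRayTransform, _root_.sum_apply]
  rfl

theorem mainTheorem2 {𝕜 : Type*} [RCLike 𝕜] (n m : ℕ) (hn : 2 ≤ n)
    (F : TensorSumDistribution 𝕜 n m)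
    (hF : ∀ k : ℕ, k ≤ m → generalizedMRT k F = 0) : F = 0 := by
  let κ := (p : Fin (m + 1)) × (Fin p → Fin n)
  let d : κ → ℕ := fun r => r.1
  let i : ∀ r : κ, Fin (d r) → Fin n := fun r => r.2
  let u : κ → CompactDistribution 𝕜 n := fun r => (F r.1).1 r.2
  have hpair : ∀ k ≤ m, ∀ ψ : 𝓓(nonzeroDirections n, ℝ),
      ∑ r, (u r).1 (adjointMRT k (i r) ψ) = 0 := fun k hk ψ => by
    rw [← generalizedMRT_apply k F ψ, hF k hk]
    rfl
  have hcontr := contraction_linForm_pow_eq_zero (d := d) (i := i) (u := fun r => (u r).1) hn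
    (fun r => Nat.lt_succ_iff.1 r.1.2)
    fun k hk l y ξ hξ => contraction_ridge_eq_zero hpair l y ξ hξ k hk
  have hlin : ∀ (l : ℕ) (y : EuclideanSpace ℝ (Fin n)) (p : Fin (m + 1)) (i : Fin p → Fin n),
      ((F p).1 i).1 (polyFun n (linForm y ^ l)) = 0 := by
    intro l y p
    refine congrFun (symmetric_tensor_eq_zero
      (fun i => ((F p).1 i).1 (polyFun n (linForm y ^ l))) (fun σ i => ?_) fun ξ => ?_)
    · rw [(F p).2 σ i]
    -- Replacing ξ by c • ξ multiplies the degree-p part by c^p.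
    · refine eq_zero_of_sum_pow_smul_eq_zero (fun p : Fin (m + 1) => ∑ i : Fin p → Fin n,
        (∏ j, ξ (i j)) • ((F p).1 i).1 (polyFun n (linForm y ^ l))) (fun c => ?_) p
      rw [← hcontr l y (c • ξ), contraction_apply, Fintype.sum_sigma]
      refine Finset.sum_congr rfl fun p _ => ?_
      rw [Finset.smul_sum]
      refine Finset.sum_congr rfl fun i _ => ?_
      simp only [d, u, smul_smul, PiLp.smul_apply, smul_eq_mul, Finset.prod_mul_distrib,
        Finset.prod_const, Finset.card_univ, Fintype.card_fin]
      rfl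
  funext p
  refine Subtype.ext (funext fun i => compactDistribution_eq_zero _ ?_)
  -- Second polarization: the moments of a component against coordinate products of length l form a
  -- symmetric l-tensor, whose form at y is the pairing with ⟪y, x⟫^l.
  refine pairing_polyFun_eq_zero _ fun l => congrFun (symmetric_tensor_eq_zero
    (fun J => ((F p).1 i).1 (polyFun n (∏ j, MvPolynomial.X (J j)))) (fun σ J => ?_) fun y => ?_)
  · simp only [Function.comp_apply]
    rw [Equiv.prod_comp σ fun j => (MvPolynomial.X (J j) : MvPolynomial (Fin n) ℝ)]
  · rw [← hlin l y p i, linForm, Fintype.sum_pow, map_sum, map_sum]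
    refine Finset.sum_congr rfl fun J _ => ?_
    rw [← map_smul, ← map_smul, Finset.prod_mul_distrib, MvPolynomial.smul_eq_C_mul, map_prod]
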